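/- **Setting.** Let $n,m,t\ge 0$ be integers. A *Pauli string* on a finite register of qubits is a tensor product of the matrices $I,X,Y,Z$ considered modulo phases, and a *stabilizer group* (modulo phases) is a subgroup of the group of Pauli strings that is maximal among the subgroups whose operators commute pairwise. A *stabilizer state* is a unit vector that is a common eigenvector of a stabilizer group $\mathcal Z$ (then $\mathcal Z$ is determined by the state), and a *stabilizer basis* is an orthonormal basis of common eigenvectors of a stabilizer group. A *Clifford operator* is a unitary that maps Pauli operators to Pauli operators under conjugation. Consider $n$ data qubits and $m$ ancillas initialised in a stabilizer state $|\psi\rangle$. A *$t$-doped circuit* on the $n+m$ qubits is a unitary $U=C_0\prod_{k=1}^t T_{q_k}C_k$, where $C_0,\dots,C_t$ are Clifford operators and $T_{q_k}$ is the gate $T=\mathrm{diag}(1,e^{i\pi/4})$ on qubit $q_k$. Let $\{|\Phi'_b\rangle\}_b$ be a stabilizer basis on the $n+m$ qubits with stabilizer group $\mathcal S'$. The corresponding *$t$-doped POVM* is the $n$-qubit POVM $$\mu_b=(I\otimes\langle\psi|)\,U^\dagger|\Phi'_b\rangle\langle\Phi'_b|U\,(I\otimes|\psi\rangle),\qquad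 b\in\{0,1\}^{n+m},$$ and $s_{\boldsymbol\mu}=\dim\operatorname{span}\{\mu_b\}_b$. *Gadget picture.* Add $t$ gadget qubits and replace the $k$-th $T$ gate by a CNOT with control $q_k$ and target the $k$-th gadget qubit, which gives the Clifford operator $\tilde U=C_0\prod_{k=1}^t\mathrm{CNOT}_k\,C_k$ on $n+m+t$ qubits. Let $\tilde{\mathcal S}=\tilde U^\dagger(\mathcal S'\otimes\langle Z_1,\dots,Z_t\rangle)\tilde U$ (modulo phases) be the Heisenberg-evolved stabilizer group of the measurement, with the gadget qubits measured in the computational basis. Projecting the ancillas onto $|\psi\rangle$ leaves the group of Pauli strings on the $n$ data and $t$ gadget qubits $$\mathcal S=\{\pi_{n+t}(g):\ g\in\tilde{\mathcal S},\ \pi_m(g)\in\mathcal Z\},$$ where $\mathcal Z$ is the stabilizer group of $|\psi\rangle$ modulo phases, and $\pi_{n+t},\pi_m$ restrict a Pauli string to the data and gadget qubits, and to the ancillas, respectively. Let $\mathcal S_n,\mathcal S_t\le\mathcal S$ be the subgroups of elements acting nontrivially only on the data qubits, respectively only on the gadget qubits. With $\dim$ the number of independent generators, the entanglement $p$ of the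 stabilizer states of $\mathcal S$ is given by $2p=n+t-\dim\mathcal S_n-\dim\mathcal S_t$, and these states are *maximally entangled* if $p=\min(n,t)$. **Theorem.** Suppose that $t\le n$ and $t\le m$. For every $t$-doped POVM as above such that the stabilizer states of $\mathcal S$ are maximally entangled, $$s_{\boldsymbol\mu}\le 2^n\left(\tfrac32\right)^t .$$ -/

import Mathlib

open scoped Matrix

noncomputable section

/-- Operators on the Hilbert space of a register of qubits labelled by `ι`, in the computational
basis `ι → Fin 2`. -/
abbrev QOp (ι : Type) : Type := Matrix (ι → Fin 2) (ι → Fin 2) ℂ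

/-- State vectors of a register of qubits labelled by `ι`. -/
abbrev QState (ι : Type) : Type := EuclideanSpace ℂ (ι → Fin 2)

/-- Pauli strings, i.e. Pauli operators modulo phases. The pair at qubit `i` is `(x, z)`, with
`(0,0), (1,0), (1,1), (0,1)` standing for `I, X, Y, Z`; the product of Pauli strings becomes the
addition. -/
abbrev PauliString (ι : Type) : Type := ι → ZMod 2 × ZMod 2

/-- The single-qubit Pauli matrices. -/
def pauliMatrix (p : ZMod 2 × ZMod 2) : Matrix (Fin 2) (Fin 2) ℂ :=
  if p = (0, 0) then 1
  else if p = (1, 0) then !![0, 1; 1, 0]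
  else if p = (1, 1) then !![0, -Complex.I; Complex.I, 0]
  else !![1, 0; 0, -1]

/-- The natural lift of a Pauli string to a Pauli operator: the tensor product of the Pauli
matrices at the individual qubits. -/
def pauliOp {ι : Type} [Fintype ι] (P : PauliString ι) : QOp ι :=
  Matrix.of fun x y => ∏ i, pauliMatrix (P i) (x i) (y i)

/-- Clifford operators: unitaries that map Pauli operators to Pauli operators (with phases in
`{±1, ±i}`) under conjugation. -/
def IsClifford {ι : Type} [Fintype ι] [DecidableEq ι] (U : QOp ι) : Prop :=
  U ∈ Matrix.unitaryGroup (ι → Fin 2) ℂ ∧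
    ∀ P : PauliString ι, ∃ (Q : PauliString ι) (k : ℕ),
      U * pauliOp P * Uᴴ = Complex.I ^ k • pauliOp Q

/-- Stabilizer groups modulo phases: sets of Pauli strings closed under multiplication that are
maximal among those whose operators commute pairwise. -/
def IsStabilizerGroup {ι : Type} [Fintype ι] [DecidableEq ι]
    (S : Submodule (ZMod 2) (PauliString ι)) : Prop :=
  Maximal (fun S' : Submodule (ZMod 2) (PauliString ι) =>
    ∀ P ∈ S', ∀ Q ∈ S', Commute (pauliOp P) (pauliOp Q)) S

/-- `ψ` is stabilised by `P` up to a sign. -/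
def StabilizedUpToSign {ι : Type} [Fintype ι] [DecidableEq ι]
    (P : PauliString ι) (ψ : QState ι) : Prop :=
  pauliOp P *ᵥ ψ.ofLp = ψ.ofLp ∨ pauliOp P *ᵥ ψ.ofLp = -ψ.ofLp

/-- Stabilizer states. -/
def IsStabilizerState {ι : Type} [Fintype ι] [DecidableEq ι] (ψ : QState ι) : Prop :=
  ‖ψ‖ = 1 ∧ ∃ Z : Submodule (ZMod 2) (PauliString ι),
    IsStabilizerGroup Z ∧ ∀ P ∈ Z, StabilizedUpToSign P ψ

/-- The stabilizer group (modulo phases) of a state. -/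
def stabilizerOf {ι : Type} [Fintype ι] [DecidableEq ι] (ψ : QState ι) :
    Submodule (ZMod 2) (PauliString ι) :=
  Submodule.span (ZMod 2) {P | StabilizedUpToSign P ψ}

/-- `Φ` is the stabilizer basis associated with the stabilizer group `S`: an orthonormal basis of
common eigenvectors of `S`. -/
def IsStabilizerBasis {ι : Type} [Fintype ι] [DecidableEq ι]
    (S : Submodule (ZMod 2) (PauliString ι))
    (Φ : OrthonormalBasis (ι → Fin 2) ℂ (QState ι)) : Prop :=
  IsStabilizerGroup S ∧ ∀ b, ∀ P ∈ S, StabilizedUpToSign P (Φ b)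

/-- The `T` gate `diag(1, e^{iπ/4})` acting on the qubit `q`. -/
def tGate {ι : Type} [Fintype ι] [DecidableEq ι] (q : ι) : QOp ι :=
  Matrix.diagonal fun x => if x q = 1 then Complex.exp (Real.pi / 4 * Complex.I) else 1

/-- The controlled-NOT gate with control `c` and target `d`. -/
def cnotGate {ι : Type} [Fintype ι] [DecidableEq ι] (c d : ι) : QOp ι :=
  Matrix.of fun x y => if x = Function.update y d (y d + y c) then 1 else 0

/-- The operator `A ⊗ I`, acting as `A` on the qubits `ι` and trivially on the qubits `κ`. -/
def extendOp {ι κ : Type} [Fintype κ] [DecidableEq κ] (A : QOp ι) : QOp (ι ⊕ κ) :=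
  Matrix.of fun x y => A (x ∘ Sum.inl) (y ∘ Sum.inl) *
    (if x ∘ Sum.inr = y ∘ Sum.inr then 1 else 0)

/-- A circuit made of Clifford operators `C₀, …, C_t` and `t` `T` gates between them, the `k`-th
one acting on the qubit `site k`. -/
structure DopedCircuit (ι : Type) [Fintype ι] [DecidableEq ι] (t : ℕ) where
  clifford : Fin (t + 1) → QOp ι
  site : Fin t → ι
  isClifford : ∀ k, IsClifford (clifford k)

/-- The unitary `C₀ (T C₁) (T C₂) ⋯ (T C_t)` implemented by a `t`-doped circuit. -/
def DopedCircuit.unitary {ι : Type} [Fintype ι] [DecidableEq ι] {t : ℕ}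
    (C : DopedCircuit ι t) : QOp ι :=
  C.clifford 0 * (List.ofFn fun k : Fin t => tGate (C.site k) * C.clifford k.succ).prod

/-- The Clifford operator `C₀ (CNOT₁ C₁) ⋯ (CNOT_t C_t)` of the gadget picture: there is one
gadget qubit per `T` gate, and the `k`-th `T` gate is replaced by a CNOT controlled by the qubit on
which it acts and with the `k`-th gadget qubit as its target. -/
def DopedCircuit.gadgetUnitary {ι : Type} [Fintype ι] [DecidableEq ι] {t : ℕ}
    (C : DopedCircuit ι t) : QOp (ι ⊕ Fin t) :=
  extendOp (C.clifford 0) *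
    (List.ofFn fun k : Fin t =>
      cnotGate (Sum.inl (C.site k)) (Sum.inr k) * extendOp (C.clifford k.succ)).prod

/-- The restriction of Pauli strings to a subregister, given by an embedding `f` of its qubits. -/
abbrev restrictTo {κ ι : Type} (f : κ → ι) : PauliString ι →ₗ[ZMod 2] PauliString κ :=
  LinearMap.funLeft (ZMod 2) (ZMod 2 × ZMod 2) f

/-- The group generated by the operators `Z` on the individual qubits, which describes
measurements in the computational basis. -/
def zGroup (κ : Type) : Submodule (ZMod 2) (PauliString κ) where
  carrier := {P | ∀ i, (P i).1 = 0}
  add_mem' := fun {P Q} hP hQ i => by simp [hP i, hQ i]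
  zero_mem' := fun _ => rfl
  smul_mem' := fun c P hP i => by simp [hP i]

/-- The Heisenberg evolution `U† S U` (modulo phases) of a group of Pauli strings. -/
def heisenberg {ι : Type} [Fintype ι] [DecidableEq ι] (U : QOp ι)
    (S : Submodule (ZMod 2) (PauliString ι)) : Submodule (ZMod 2) (PauliString ι) :=
  Submodule.span (ZMod 2)
    {P | ∃ Q ∈ S, ∃ k : ℕ, Uᴴ * pauliOp Q * U = Complex.I ^ k • pauliOp P}

/-- The stabilizer group of the physical measurement in the gadget picture: `S` on the original
qubits, and a computational basis measurement on the gadget qubits. -/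
def gadgetMeasurement {ι : Type} (t : ℕ) (S : Submodule (ZMod 2) (PauliString ι)) :
    Submodule (ZMod 2) (PauliString (ι ⊕ Fin t)) :=
  S.comap (restrictTo Sum.inl) ⊓ (zGroup (Fin t)).comap (restrictTo Sum.inr)

/-- The stabilizer group obtained from `S` by projecting the `m` ancillas onto the stabilizer
state `ψ`: the restrictions to the other `n + t` qubits of those elements of `S` whose ancilla part
belongs, up to phases, to the stabilizer group of `ψ`. -/
def projectAncillas {n m t : ℕ} (ψ : QState (Fin m))
    (S : Submodule (ZMod 2) (PauliString ((Fin n ⊕ Fin m) ⊕ Fin t))) :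
    Submodule (ZMod 2) (PauliString (Fin n ⊕ Fin t)) :=
  (S ⊓ (stabilizerOf ψ).comap (restrictTo (Sum.inl ∘ Sum.inr))).map
    (restrictTo (Sum.map Sum.inl id))

/-- The stabilizer group on the `n` data qubits and `t` gadget qubits that describes the
measurement performed by a `t`-doped circuit in the gadget picture: Heisenberg evolution of the
physical measurement through the gadget circuit, then projection of the ancillas. -/
def gadgetStabilizerGroup {n m t : ℕ} (C : DopedCircuit (Fin n ⊕ Fin m) t)
    (ψ : QState (Fin m)) (S : Submodule (ZMod 2) (PauliString (Fin n ⊕ Fin m))) :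
    Submodule (ZMod 2) (PauliString (Fin n ⊕ Fin t)) :=
  projectAncillas ψ (heisenberg C.gadgetUnitary (gadgetMeasurement t S))

/-- The elements of `S` that act nontrivially only on the first subregister. -/
def localLeft {ι κ : Type} (S : Submodule (ZMod 2) (PauliString (ι ⊕ κ))) :
    Submodule (ZMod 2) (PauliString (ι ⊕ κ)) :=
  S ⊓ LinearMap.ker (restrictTo Sum.inr)

/-- The elements of `S` that act nontrivially only on the second subregister. -/
def localRight {ι κ : Type} (S : Submodule (ZMod 2) (PauliString (ι ⊕ κ))) :
    Submodule (ZMod 2) (PauliString (ι ⊕ κ)) :=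
  S ⊓ LinearMap.ker (restrictTo Sum.inl)

/-- The entanglement `p` of the stabilizer states of `S` between two subregisters of `n` and `t`
qubits: `2 p = n + t - dim S_n - dim S_t`. -/
def stabEntanglement {n t : ℕ} (S : Submodule (ZMod 2) (PauliString (Fin n ⊕ Fin t))) : ℚ :=
  ((n : ℚ) + t - Module.finrank (ZMod 2) (localLeft S)
    - Module.finrank (ZMod 2) (localRight S)) / 2

/-- The stabilizer states of `S` are maximally entangled: `p = min(n, t)`. -/
def IsMaximallyEntangled {n t : ℕ}
    (S : Submodule (ZMod 2) (PauliString (Fin n ⊕ Fin t))) : Prop :=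
  stabEntanglement S = (min n t : ℕ)

/-- The isometry `I ⊗ |ψ⟩` that appends ancillas `κ` in the state `ψ`. -/
def appendState {ι κ : Type} [Fintype ι] [DecidableEq ι] (ψ : QState κ) :
    Matrix (ι ⊕ κ → Fin 2) (ι → Fin 2) ℂ :=
  Matrix.of fun x a => if x ∘ Sum.inl = a then ψ (x ∘ Sum.inr) else 0

/-- The effective POVM `μ_b = (I ⊗ ⟨ψ|) U† |Φ_b⟩⟨Φ_b| U (I ⊗ |ψ⟩)` on the qubits `ι`. -/
def effectivePOVM {ι κ : Type} [Fintype ι] [DecidableEq ι] [Fintype κ] [DecidableEq κ]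
    (U : QOp (ι ⊕ κ)) (ψ : QState κ)
    (Φ : OrthonormalBasis (ι ⊕ κ → Fin 2) ℂ (QState (ι ⊕ κ))) (b : ι ⊕ κ → Fin 2) : QOp ι :=
  (appendState (ι := ι) ψ)ᴴ * (Uᴴ * Matrix.vecMulVec (Φ b).ofLp (star (Φ b).ofLp) * U) *
    appendState (ι := ι) ψ

/-- `s_μ`, the dimension of the linear span of the elements of a POVM. -/
def povmSpanDim {ι β : Type} (μ : β → QOp ι) : ℕ :=
  Module.finrank ℂ (Submodule.span ℂ (Set.range μ))

end

/-! The POVM elements are expanded in Pauli operators, and the strings that can occur are counted. A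
stabilizer projector involves only strings of its group (`vecMulVec_mem_span`), so it suffices to
follow Pauli strings backwards through the circuit.

A `T` gate fixes a string acting as I or Z on its qubit and mixes X with Y otherwise
(`tGate_conj_pauliOp`). In the gadget picture, measuring I or Z on the gadget qubit labels the two
terms: pulled back through the CNOT, they leave the gadget factors X and Y if the string has X or Y
there, and I and Z if it has I or Z. In the last case the second term is absent, so a factor Z on a
gadget qubit never contributes. Hence every POVM element is a combination of data parts of elements
of the gadget stabilizer group whose gadget part lies in {I, X, Y}^t (`effectivePOVM_mem_span`);
ancilla parts outside the stabilizer group of ψ have expectation zero.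

There are at most 3^t such gadget parts, and the elements with a given one differ by elements acting
on the data alone (`ncard_no_Z_le`). Maximal entanglement leaves at most n - t generators for the
latter, so the span has dimension at most 2^(n-t) 3^t = 2^n (3/2)^t. -/

/-! ### Tensor products of single-qubit operators -/

/-- The tensor product of single-qubit operators. -/
def tensorOp {ι : Type} [Fintype ι] (A : ι → Matrix (Fin 2) (Fin 2) ℂ) : QOp ι :=
  Matrix.of fun x y => ∏ i, A i (x i) (y i)

section Tensor

variable {ι : Type} [Fintype ι]

theorem pauliOp_eq_tensorOp (P : PauliString ι) :
    pauliOp P = tensorOp fun i => pauliMatrix (P i) := rfl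

theorem tensorOp_mul [DecidableEq ι] (A B : ι → Matrix (Fin 2) (Fin 2) ℂ) :
    tensorOp A * tensorOp B = tensorOp fun i => A i * B i := by
  ext x y
  simp only [tensorOp, Matrix.mul_apply, Matrix.of_apply, ← Finset.prod_mul_distrib]
  rw [Finset.prod_univ_sum, Fintype.piFinset_univ]

theorem trace_tensorOp [DecidableEq ι] (A : ι → Matrix (Fin 2) (Fin 2) ℂ) :
    (tensorOp A).trace = ∏ i, (A i).trace := by
  simp only [tensorOp, Matrix.trace, Matrix.diag_apply, Matrix.of_apply]
  rw [Finset.prod_univ_sum, Fintype.piFinset_univ]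

theorem tensorOp_smul (c : ι → ℂ) (A : ι → Matrix (Fin 2) (Fin 2) ℂ) :
    (tensorOp fun i => c i • A i) = (∏ i, c i) • tensorOp A := by
  ext x y
  simp [tensorOp, Finset.prod_mul_distrib]

theorem tensorOp_one : (tensorOp fun _ : ι => (1 : Matrix (Fin 2) (Fin 2) ℂ)) = 1 := by
  ext x y
  simp only [tensorOp, Matrix.of_apply, Matrix.one_apply]
  by_cases h : x = y
  · simp [h]
  · rw [if_neg h]
    obtain ⟨i, hi⟩ := Function.ne_iff.mp h
    exact Finset.prod_eq_zero (Finset.mem_univ i) (if_neg hi)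

theorem conjTranspose_tensorOp (A : ι → Matrix (Fin 2) (Fin 2) ℂ) :
    (tensorOp A)ᴴ = tensorOp fun i => (A i)ᴴ := by
  ext x y
  simp [tensorOp, Matrix.conjTranspose_apply]

end Tensor

/-! ### Single-qubit Pauli matrices -/

@[simp]
theorem pauliMatrix_I : pauliMatrix (0, 0) = 1 := by simp [pauliMatrix]

@[simp]
theorem pauliMatrix_X : pauliMatrix (1, 0) = !![0, 1; 1, 0] := by simp [pauliMatrix]

@[simp]
theorem pauliMatrix_Y : pauliMatrix (1, 1) = !![0, -Complex.I; Complex.I, 0] := by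
  simp [pauliMatrix]

@[simp]
theorem pauliMatrix_Z : pauliMatrix (0, 1) = !![1, 0; 0, -1] := by simp [pauliMatrix]

theorem zmod_two_eq (a : ZMod 2) : a = 0 ∨ a = 1 := by
  revert a; decide

theorem pauli_cases (p : ZMod 2 × ZMod 2) :
    p = (0, 0) ∨ p = (1, 0) ∨ p = (1, 1) ∨ p = (0, 1) := by
  revert p; decide

theorem zmod_two_one_add_one : (1 + 1 : ZMod 2) = 0 := by decide

theorem pauliMatrix_conjTranspose (p : ZMod 2 × ZMod 2) :
    (pauliMatrix p)ᴴ = pauliMatrix p := by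
  rcases pauli_cases p with rfl | rfl | rfl | rfl <;> ext i j <;> fin_cases i <;> fin_cases j <;>
    simp [Matrix.conjTranspose_apply]

theorem pauliMatrix_mul_self (p : ZMod 2 × ZMod 2) : pauliMatrix p * pauliMatrix p = 1 := by
  rcases pauli_cases p with rfl | rfl | rfl | rfl <;> ext i j <;> fin_cases i <;> fin_cases j <;>
    simp

theorem pauliMatrix_mul_comm_sign (p q : ZMod 2 × ZMod 2) :
    ∃ s : ℂ, (s = 1 ∨ s = -1) ∧
      pauliMatrix p * pauliMatrix q = s • (pauliMatrix q * pauliMatrix p) := by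
  rcases pauli_cases p with rfl | rfl | rfl | rfl <;>
    rcases pauli_cases q with rfl | rfl | rfl | rfl <;>
    first
    | (refine ⟨1, Or.inl rfl, ?_⟩
       ext i j; fin_cases i <;> fin_cases j <;> simp <;> done)
    | (refine ⟨-1, Or.inr rfl, ?_⟩
       ext i j; fin_cases i <;> fin_cases j <;> simp)

theorem pauliMatrix_add (p q : ZMod 2 × ZMod 2) :
    ∃ c : ℂ, pauliMatrix (p + q) = c • (pauliMatrix p * pauliMatrix q) := by
  rcases pauli_cases p with rfl | rfl | rfl | rfl <;>
    rcases pauli_cases q with rfl | rfl | rfl | rfl <;>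
    simp only [Prod.mk_add_mk, add_zero, zero_add, zmod_two_one_add_one] <;>
    first
    | (refine ⟨1, ?_⟩
       ext i j; fin_cases i <;> fin_cases j <;> simp <;> done)
    | (refine ⟨Complex.I, ?_⟩
       ext i j; fin_cases i <;> fin_cases j <;> simp <;> done)
    | (refine ⟨-Complex.I, ?_⟩
       ext i j; fin_cases i <;> fin_cases j <;> simp)

theorem trace_pauliMatrix_mul (p q : ZMod 2 × ZMod 2) (h : p ≠ q) :
    (pauliMatrix p * pauliMatrix q).trace = 0 := by
  rcases pauli_cases p with rfl | rfl | rfl | rfl <;>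
    rcases pauli_cases q with rfl | rfl | rfl | rfl <;>
    first
    | exact absurd rfl h
    | simp [Matrix.trace_fin_two]

/-- On two copies of a qubit, the sum of σ ⊗ σ over the Pauli matrices is twice the swap. Tensoring
this identity over the qubits gives `sum_pauliOp_mul`. -/
theorem sum_pauliMatrix_mul (a b c d : Fin 2) :
    ∑ p : ZMod 2 × ZMod 2, pauliMatrix p a b * pauliMatrix p c d =
      2 * ((1 : Matrix (Fin 2) (Fin 2) ℂ) a d * (1 : Matrix (Fin 2) (Fin 2) ℂ) b c) := by
  have h2 (f : ZMod 2 → ℂ) : ∑ x, f x = f 0 + f 1 := Fin.sum_univ_two f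
  rw [Fintype.sum_prod_type]
  simp only [h2, pauliMatrix_I, pauliMatrix_X, pauliMatrix_Y, pauliMatrix_Z]
  fin_cases a <;> fin_cases b <;> fin_cases c <;> fin_cases d <;> norm_num

/-! ### Pauli operators -/

section Pauli

variable {ι : Type} [Fintype ι]

theorem pauliOp_conjTranspose (P : PauliString ι) : (pauliOp P)ᴴ = pauliOp P := by
  simp only [pauliOp_eq_tensorOp, conjTranspose_tensorOp, pauliMatrix_conjTranspose]

theorem pauliOp_zero : pauliOp (0 : PauliString ι) = 1 := by
  simp only [pauliOp_eq_tensorOp, Pi.zero_apply, ← tensorOp_one, ← pauliMatrix_I, Prod.zero_eq_mk]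

variable [DecidableEq ι]

theorem pauliOp_mul_self (P : PauliString ι) : pauliOp P * pauliOp P = 1 := by
  simp only [pauliOp_eq_tensorOp, tensorOp_mul, pauliMatrix_mul_self, tensorOp_one]

theorem pauliOp_commute_or_anticommute (P Q : PauliString ι) :
    Commute (pauliOp P) (pauliOp Q) ∨ pauliOp P * pauliOp Q = -(pauliOp Q * pauliOp P) := by
  choose s hs h using fun i => pauliMatrix_mul_comm_sign (P i) (Q i)
  have key : pauliOp P * pauliOp Q = (∏ i, s i) • (pauliOp Q * pauliOp P) := by
    simp only [pauliOp_eq_tensorOp, tensorOp_mul, ← tensorOp_smul, h]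
  have hsign : (∏ i, s i) = 1 ∨ (∏ i, s i) = -1 := by
    refine Finset.prod_induction s (fun c => c = 1 ∨ c = -1) ?_ (Or.inl rfl) fun i _ => hs i
    rintro a b (rfl | rfl) (rfl | rfl) <;> simp
  rcases hsign with hc | hc <;> rw [hc] at key
  · left; simpa [Commute, SemiconjBy] using key
  · right; simpa using key

theorem pauliOp_add (P Q : PauliString ι) :
    ∃ c : ℂ, pauliOp (P + Q) = c • (pauliOp P * pauliOp Q) := by
  choose c h using fun i => pauliMatrix_add (P i) (Q i)
  refine ⟨∏ i, c i, ?_⟩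
  simp only [pauliOp_eq_tensorOp, tensorOp_mul, ← tensorOp_smul, ← h, Pi.add_apply]

/-- Traces of tensor products multiply, so a single qubit on which the strings differ suffices. -/
theorem trace_pauliOp_mul {P Q : PauliString ι} (h : P ≠ Q) :
    (pauliOp P * pauliOp Q).trace = 0 := by
  obtain ⟨i, hi⟩ := Function.ne_iff.mp h
  rw [pauliOp_eq_tensorOp, pauliOp_eq_tensorOp, tensorOp_mul, trace_tensorOp]
  exact Finset.prod_eq_zero (Finset.mem_univ i) (trace_pauliMatrix_mul _ _ hi)

/-- Pauli operators that agree up to a scalar come from the same Pauli string. -/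
theorem eq_of_pauliOp_eq_smul {P Q : PauliString ι} {c : ℂ} (h : pauliOp P = c • pauliOp Q) :
    P = Q := by
  by_contra hne
  have h1 := trace_pauliOp_mul hne
  have h2 : (pauliOp P * pauliOp P).trace = c * (pauliOp P * pauliOp Q).trace := by
    nth_rewrite 2 [h]
    rw [Matrix.mul_smul, Matrix.trace_smul, smul_eq_mul]
  rw [pauliOp_mul_self, h1, mul_zero, Matrix.trace_one] at h2
  simp at h2

/-- The completeness relation of the Pauli operators. -/
theorem sum_pauliOp_mul (a b c d : ι → Fin 2) :
    ∑ P : PauliString ι, pauliOp P a b * pauliOp P c d =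
      2 ^ Fintype.card ι * ((1 : QOp ι) a d * (1 : QOp ι) b c) := by
  have h := Finset.prod_univ_sum (fun _ : ι => (Finset.univ : Finset (ZMod 2 × ZMod 2)))
    (fun i p => pauliMatrix p (a i) (b i) * pauliMatrix p (c i) (d i))
  rw [Fintype.piFinset_univ] at h
  simp only [pauliOp, Matrix.of_apply, ← Finset.prod_mul_distrib]
  rw [← h]
  simp only [sum_pauliMatrix_mul, Finset.prod_mul_distrib, Finset.prod_const, Finset.card_univ]
  rw [← tensorOp_one]
  rfl

/-- The expansion of an operator in the Pauli operators. -/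
theorem sum_trace_smul_pauliOp (M : QOp ι) :
    ∑ P : PauliString ι, (pauliOp P * M).trace • pauliOp P = (2 : ℂ) ^ Fintype.card ι • M := by
  ext c d
  simp only [Matrix.sum_apply, Matrix.smul_apply, smul_eq_mul, Matrix.trace, Matrix.diag_apply,
    Matrix.mul_apply, Finset.sum_mul]
  rw [Finset.sum_comm]
  simp_rw [Finset.sum_comm (s := (Finset.univ : Finset (PauliString ι)))]
  have (a b : ι → Fin 2) : ∑ P : PauliString ι, pauliOp P a b * M b a * pauliOp P c d =
      2 ^ Fintype.card ι * ((1 : QOp ι) a d * (1 : QOp ι) b c) * M b a := by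
    rw [← sum_pauliOp_mul, Finset.sum_mul]
    exact Finset.sum_congr rfl fun P _ => by ring
  simp only [this, Matrix.one_apply]
  simp [ite_mul, mul_ite]

theorem mem_span_pauliOp_of_trace {s : Set (PauliString ι)} {M : QOp ι}
    (h : ∀ P ∉ s, (pauliOp P * M).trace = 0) :
    M ∈ Submodule.span ℂ (pauliOp '' s) := by
  have hM : M = ((2 : ℂ) ^ Fintype.card ι)⁻¹ •
      ∑ P : PauliString ι, (pauliOp P * M).trace • pauliOp P := by
    rw [sum_trace_smul_pauliOp, smul_smul, inv_mul_cancel₀ (pow_ne_zero _ two_ne_zero), one_smul]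
  rw [hM]
  refine Submodule.smul_mem _ _ (Submodule.sum_mem _ fun P _ => ?_)
  by_cases hP : P ∈ s
  · exact Submodule.smul_mem _ _ (Submodule.subset_span ⟨P, hP, rfl⟩)
  · rw [h P hP, zero_smul]
    exact Submodule.zero_mem _

/-! ### Stabilizer groups and expectation values -/

/-- A Pauli string commuting with all of a stabilizer group belongs to it. -/
theorem IsStabilizerGroup.mem_of_commute {S : Submodule (ZMod 2) (PauliString ι)}
    (hS : IsStabilizerGroup S) {P : PauliString ι}
    (hP : ∀ Q ∈ S, Commute (pauliOp P) (pauliOp Q)) : P ∈ S := by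
  -- Adjoining `P` to `S` keeps the group commuting, so maximality forces `P` into `S`. Over `ZMod
  -- 2` the adjoined part is either the identity or `P` itself.
  have hcomm : ∀ A ∈ S ⊔ Submodule.span (ZMod 2) {P}, ∀ B ∈ S ⊔ Submodule.span (ZMod 2) {P},
      Commute (pauliOp A) (pauliOp B) := by
    have hspan (a : ZMod 2) : pauliOp (a • P) = 1 ∨ pauliOp (a • P) = pauliOp P := by
      rcases zmod_two_eq a with rfl | rfl
      · left; rw [zero_smul, pauliOp_zero]
      · right; rw [one_smul]
    intro A hA B hB
    obtain ⟨A₁, hA₁, A₂, hA₂, rfl⟩ := Submodule.mem_sup.mp hA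
    obtain ⟨B₁, hB₁, B₂, hB₂, rfl⟩ := Submodule.mem_sup.mp hB
    obtain ⟨a, rfl⟩ := Submodule.mem_span_singleton.mp hA₂
    obtain ⟨b, rfl⟩ := Submodule.mem_span_singleton.mp hB₂
    obtain ⟨c, hc⟩ := pauliOp_add A₁ (a • P)
    obtain ⟨d, hd⟩ := pauliOp_add B₁ (b • P)
    rw [hc, hd]
    refine Commute.smul_left (Commute.smul_right (Commute.mul_left (Commute.mul_right ?_ ?_)
      (Commute.mul_right ?_ ?_)) _) _
    · exact hS.1 _ hA₁ _ hB₁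
    · rcases hspan b with h | h <;> rw [h]
      · exact Commute.one_right _
      · exact (hP _ hA₁).symm
    · rcases hspan a with h | h <;> rw [h]
      · exact Commute.one_left _
      · exact hP _ hB₁
    · rcases hspan a with h | h <;> rcases hspan b with h' | h' <;> rw [h, h']
      · exact Commute.one_left _
      · exact Commute.one_left _
      · exact Commute.one_right _
      · exact Commute.refl _
  have hle := hS.2 hcomm le_sup_left
  exact hle (Submodule.mem_sup_right (Submodule.mem_span_singleton_self P))

/-- Pauli operators outside the stabilizer group have vanishing expectation value. -/
theorem expectation_eq_zero {S : Submodule (ZMod 2) (PauliString ι)}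
    (hS : IsStabilizerGroup S) {v : QState ι} (hv : ∀ Q ∈ S, StabilizedUpToSign Q v)
    {P : PauliString ι} (hP : P ∉ S) : star v.ofLp ⬝ᵥ (pauliOp P *ᵥ v.ofLp) = 0 := by
  obtain ⟨Q, hQ, hPQ⟩ : ∃ Q ∈ S, ¬ Commute (pauliOp P) (pauliOp Q) := by
    by_contra! h
    exact hP (hS.mem_of_commute h)
  have hanti := (pauliOp_commute_or_anticommute P Q).resolve_left hPQ
  -- The expectation of QPQ is computed twice: the sign in Qv = ±v cancels, while anticommutation
  -- turns QPQ into -P.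
  have h1 : star (pauliOp Q *ᵥ v.ofLp) ⬝ᵥ (pauliOp P *ᵥ (pauliOp Q *ᵥ v.ofLp)) =
      star v.ofLp ⬝ᵥ (pauliOp P *ᵥ v.ofLp) := by
    rcases hv Q hQ with h | h <;> rw [h]
    simp [Matrix.mulVec_neg]
  have h2 : star (pauliOp Q *ᵥ v.ofLp) ⬝ᵥ (pauliOp P *ᵥ (pauliOp Q *ᵥ v.ofLp)) =
      -(star v.ofLp ⬝ᵥ (pauliOp P *ᵥ v.ofLp)) := by
    rw [Matrix.star_mulVec, pauliOp_conjTranspose, ← Matrix.dotProduct_mulVec,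
      Matrix.mulVec_mulVec, Matrix.mulVec_mulVec, mul_assoc, hanti, mul_neg, ← mul_assoc,
      pauliOp_mul_self, one_mul, Matrix.neg_mulVec, dotProduct_neg]
  rw [h1] at h2
  exact self_eq_neg.mp h2

/-- The projector onto a stabilizer state lies in the span of the stabilizer group. -/
theorem vecMulVec_mem_span {S : Submodule (ZMod 2) (PauliString ι)}
    (hS : IsStabilizerGroup S) {v : QState ι} (hv : ∀ Q ∈ S, StabilizedUpToSign Q v) :
    Matrix.vecMulVec v.ofLp (star v.ofLp) ∈
      Submodule.span ℂ (pauliOp '' (S : Set (PauliString ι))) := by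
  refine mem_span_pauliOp_of_trace fun P hP => ?_
  rw [Matrix.mul_vecMulVec, Matrix.trace_vecMulVec, dotProduct_comm]
  exact expectation_eq_zero hS hv hP

end Pauli

/-! ### Conjugation of Pauli strings -/

/-- `U† Q U` is the Pauli string `P` up to a phase. -/
def ConjugatesTo {ι : Type} [Fintype ι] [DecidableEq ι] (U : QOp ι) (Q P : PauliString ι) : Prop :=
  ∃ k : ℕ, Uᴴ * pauliOp Q * U = Complex.I ^ k • pauliOp P

/-- The tensor product of operators on two registers. -/
def kronOp {ι κ : Type} (A : QOp ι) (B : QOp κ) : QOp (ι ⊕ κ) :=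
  Matrix.of fun x y => A (x ∘ Sum.inl) (y ∘ Sum.inl) * B (x ∘ Sum.inr) (y ∘ Sum.inr)

theorem conjTranspose_kronOp {ι κ : Type} (A : QOp ι) (B : QOp κ) : (kronOp A B)ᴴ = kronOp Aᴴ Bᴴ := by
  ext x y
  simp [kronOp, Matrix.conjTranspose_apply]

theorem extendOp_eq_kronOp {ι κ : Type} [Fintype κ] [DecidableEq κ] (A : QOp ι) :
    (extendOp A : QOp (ι ⊕ κ)) = kronOp A 1 := by
  ext x y
  simp [extendOp, kronOp, Matrix.one_apply]

theorem pauliOp_eq_kronOp {ι κ : Type} [Fintype ι] [Fintype κ] (P : PauliString (ι ⊕ κ)) :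
    pauliOp P = kronOp (pauliOp (P ∘ Sum.inl)) (pauliOp (P ∘ Sum.inr)) := by
  ext x y
  simp [pauliOp, kronOp, Fintype.prod_sum_type]

section Conjugation

variable {ι : Type} [Fintype ι] [DecidableEq ι]

theorem ConjugatesTo.one (Q : PauliString ι) : ConjugatesTo 1 Q Q :=
  ⟨0, by simp⟩

theorem ConjugatesTo.mul {U V : QOp ι} {P Q R : PauliString ι} (hU : ConjugatesTo U P Q)
    (hV : ConjugatesTo V Q R) : ConjugatesTo (U * V) P R := by
  obtain ⟨k, hk⟩ := hU
  obtain ⟨l, hl⟩ := hV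
  refine ⟨k + l, ?_⟩
  calc (U * V)ᴴ * pauliOp P * (U * V) = Vᴴ * (Uᴴ * pauliOp P * U) * V := by
        simp only [Matrix.conjTranspose_mul, Matrix.mul_assoc]
    _ = Complex.I ^ (k + l) • pauliOp R := by
        rw [hk, Matrix.mul_smul, Matrix.smul_mul, hl, smul_smul, pow_add]

/-- The Heisenberg evolution under a Clifford operator maps Pauli strings to Pauli strings. -/
theorem IsClifford.exists_conjugatesTo {U : QOp ι} (hU : IsClifford U)
    (Q : PauliString ι) : ∃ P, ConjugatesTo U Q P := by
  obtain ⟨hunit, hconj⟩ := hU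
  have hUU : Uᴴ * U = 1 := (Matrix.mem_unitaryGroup_iff').mp hunit
  choose f k hf using hconj
  have hback (P : PauliString ι) :
      pauliOp P = Complex.I ^ k P • (Uᴴ * pauliOp (f P) * U) := by
    calc pauliOp P = (Uᴴ * U) * pauliOp P * (Uᴴ * U) := by rw [hUU, one_mul, mul_one]
      _ = Uᴴ * (U * pauliOp P * Uᴴ) * U := by simp only [Matrix.mul_assoc]
      _ = _ := by rw [hf, Matrix.mul_smul, Matrix.smul_mul]
  -- Since i has order 4, the exponent `3 * l` inverts the phase while staying a natural number.
  have hinv (l : ℕ) : Complex.I ^ (3 * l) * Complex.I ^ l = 1 := by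
    rw [← pow_add, show 3 * l + l = 4 * l by ring, pow_mul, Complex.I_pow_four, one_pow]
  have hback' (P : PauliString ι) :
      Uᴴ * pauliOp (f P) * U = Complex.I ^ (3 * k P) • pauliOp P := by
    rw [hback P, smul_smul, hinv, one_smul]
  -- `IsClifford` concerns U P U†, whereas the Heisenberg picture needs U† Q U. The induced map on
  -- the finite set of strings is injective, hence surjective, so every `Q` has a preimage.
  have hinj : Function.Injective f := fun P P' h => by
    have h1 := hback P
    rw [h, hback', smul_smul] at h1
    exact eq_of_pauliOp_eq_smul h1
  obtain ⟨P, rfl⟩ := (Finite.injective_iff_surjective.mp hinj) Q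
  exact ⟨P, 3 * k P, hback' P⟩

/-! ### Bipartite registers -/

variable {κ : Type} [Fintype κ] [DecidableEq κ]

theorem kronOp_mul (A A' : QOp ι) (B B' : QOp κ) :
    kronOp A B * kronOp A' B' = kronOp (A * A') (B * B') := by
  ext x y
  simp only [kronOp, Matrix.mul_apply, Matrix.of_apply]
  rw [Finset.sum_mul_sum, ← Fintype.sum_prod_type',
    ← (Equiv.sumArrowEquivProdArrow ι κ (Fin 2)).sum_comp]
  refine Finset.sum_congr rfl fun z _ => ?_
  exact mul_mul_mul_comm _ _ _ _

theorem ConjugatesTo.extendOp {A : QOp ι} {Q P : PauliString ι}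
    (h : ConjugatesTo A Q P) (w : PauliString κ) :
    ConjugatesTo (extendOp A : QOp (ι ⊕ κ)) (Sum.elim Q w) (Sum.elim P w) := by
  obtain ⟨k, hk⟩ := h
  refine ⟨k, ?_⟩
  rw [extendOp_eq_kronOp, pauliOp_eq_kronOp, pauliOp_eq_kronOp (Sum.elim P w),
    conjTranspose_kronOp, kronOp_mul, kronOp_mul]
  simp only [Sum.elim_comp_inl, Sum.elim_comp_inr, hk, Matrix.conjTranspose_one, one_mul, mul_one]
  ext x y
  simp [kronOp, mul_assoc]

/-- Projecting ancillas onto a state turns a Pauli operator into its data part times an expectation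
value. -/
theorem appendState_conj_pauliOp (ψ : QState κ)
    (P : PauliString (ι ⊕ κ)) :
    (appendState (ι := ι) ψ)ᴴ * pauliOp P * appendState (ι := ι) ψ =
      (star ψ.ofLp ⬝ᵥ (pauliOp (P ∘ Sum.inr) *ᵥ ψ.ofLp)) • pauliOp (P ∘ Sum.inl) := by
  have hsum (f : (ι → Fin 2) → (κ → Fin 2) → ℂ) :
      ∑ x : ι ⊕ κ → Fin 2, f (x ∘ Sum.inl) (x ∘ Sum.inr) = ∑ a, ∑ b, f a b := by
    rw [← Fintype.sum_prod_type', ← (Equiv.sumArrowEquivProdArrow ι κ (Fin 2)).sum_comp]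
    rfl
  ext a b
  rw [Matrix.mul_assoc, pauliOp_eq_kronOp]
  simp only [Matrix.mul_apply, Matrix.smul_apply, smul_eq_mul, dotProduct, Matrix.mulVec,
    Matrix.conjTranspose_apply, appendState, kronOp, Matrix.of_apply, Pi.star_apply]
  have hinner (x : ι ⊕ κ → Fin 2) := hsum fun a' c =>
    pauliOp (P ∘ Sum.inl) (x ∘ Sum.inl) a' * pauliOp (P ∘ Sum.inr) (x ∘ Sum.inr) c *
      (if a' = b then ψ c else 0)
  simp only [hinner]
  rw [hsum fun a' c => star (if a' = a then ψ c else 0) * ∑ a'', ∑ d,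
    pauliOp (P ∘ Sum.inl) a' a'' * pauliOp (P ∘ Sum.inr) c d * (if a'' = b then ψ d else 0)]
  simp only [apply_ite star, star_zero, ite_mul, zero_mul, mul_ite, mul_zero, Finset.sum_mul,
    Finset.mul_sum]
  rw [Finset.sum_comm]
  simp only [Finset.sum_ite_eq', Finset.mem_univ, if_true, Finset.sum_ite_irrel,
    Finset.sum_const_zero]
  refine Finset.sum_congr rfl fun c _ => Finset.sum_congr rfl fun d _ => ?_
  ring

end Conjugation

/-! ### The CNOT gate -/

section Cnot

variable {ι : Type} [DecidableEq ι]

/-- The action of a CNOT with control `c` and target `d` on Pauli strings. -/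
def cnotPauli (c d : ι) (P : PauliString ι) : PauliString ι :=
  Function.update (Function.update P d ((P d).1 + (P c).1, (P d).2)) c
    ((P c).1, (P c).2 + (P d).2)

/-- This is the two-qubit core of conjugation by a CNOT, with `p` on the control and `q` on the
target: the gate adds the control bit to the target bit, which shifts the indices of `q`. The phase
is always a sign, so the exponents 0 and 2 suffice. -/
theorem pauliMatrix_cnot (p q : ZMod 2 × ZMod 2) :
    ∃ k : ℕ, ∀ x y x' y' : Fin 2,
      pauliMatrix p x y * pauliMatrix q (x' + x) (y' + y) =
        Complex.I ^ k *
          (pauliMatrix (p.1, p.2 + q.2) x y * pauliMatrix (q.1 + p.1, q.2) x' y') := by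
  rcases pauli_cases p with rfl | rfl | rfl | rfl <;>
    rcases pauli_cases q with rfl | rfl | rfl | rfl <;>
    simp only [add_zero, zero_add, zmod_two_one_add_one] <;>
    first
    | (refine ⟨0, fun x y x' y' => ?_⟩
       fin_cases x <;> fin_cases y <;> fin_cases x' <;> fin_cases y' <;> simp <;> done)
    | (refine ⟨2, fun x y x' y' => ?_⟩
       fin_cases x <;> fin_cases y <;> fin_cases x' <;> fin_cases y' <;> simp)

theorem conjugatesTo_cnotGate [Fintype ι] {c d : ι} (hcd : c ≠ d) (P : PauliString ι) :
    ConjugatesTo (cnotGate c d) P (cnotPauli c d P) := by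
  obtain ⟨k, hk⟩ := pauliMatrix_cnot (P c) (P d)
  have hsplit (f : ι → ℂ) : ∏ i, f i = f c * f d * ∏ i ∈ (Finset.univ.erase c).erase d, f i := by
    rw [mul_assoc, Finset.mul_prod_erase _ f (Finset.mem_erase.mpr ⟨hcd.symm, Finset.mem_univ d⟩),
      Finset.mul_prod_erase _ f (Finset.mem_univ c)]
  refine ⟨k, ?_⟩
  ext x y
  have hentry : ((cnotGate c d)ᴴ * pauliOp P * cnotGate c d) x y =
      pauliOp P (Function.update x d (x d + x c)) (Function.update y d (y d + y c)) := by
    simp [Matrix.mul_apply, cnotGate]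
  rw [hentry, Matrix.smul_apply, smul_eq_mul]
  simp only [pauliOp, Matrix.of_apply]
  rw [hsplit, hsplit]
  have hrest : ∏ i ∈ (Finset.univ.erase c).erase d, pauliMatrix (P i)
      (Function.update x d (x d + x c) i) (Function.update y d (y d + y c) i) =
      ∏ i ∈ (Finset.univ.erase c).erase d, pauliMatrix (cnotPauli c d P i) (x i) (y i) := by
    refine Finset.prod_congr rfl fun i hi => ?_
    obtain ⟨hid, hi'⟩ := Finset.mem_erase.mp hi
    have hic := (Finset.mem_erase.mp hi').1
    simp [cnotPauli, hid, hic]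
  rw [hrest]
  simp only [cnotPauli, Function.update_self, Function.update_of_ne hcd,
    Function.update_of_ne hcd.symm]
  rw [hk]
  ring

end Cnot

/-! ### The T gate -/

section TGate

variable {ι : Type} [Fintype ι] [DecidableEq ι]

/-- I and Z are diagonal and commute with T. The off-diagonal entries of X and Y pick up ω and its
conjugate, which rotates X and Y into each other; adding 1 to the second bit exchanges them. -/
theorem pauliMatrix_tGate (p : ZMod 2 × ZMod 2) :
    ∃ α β : ℂ, (p.1 = 0 → β = 0) ∧ ∀ x y : Fin 2,
      star (if x = 1 then Complex.exp (Real.pi / 4 * Complex.I) else 1) * pauliMatrix p x y *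
          (if y = 1 then Complex.exp (Real.pi / 4 * Complex.I) else 1) =
        α * pauliMatrix p x y + β * pauliMatrix (p.1, p.2 + 1) x y := by
  set ω := Complex.exp (Real.pi / 4 * Complex.I) with hω
  have hωω : starRingEnd ℂ ω * ω = 1 := by
    have := Complex.norm_exp_ofReal_mul_I (Real.pi / 4)
    push_cast at this
    rw [Complex.conj_mul', this]
    norm_num
  rcases pauli_cases p with rfl | rfl | rfl | rfl
  · refine ⟨1, 0, fun _ => rfl, fun x y => ?_⟩
    fin_cases x <;> fin_cases y <;> simp [hωω]
  -- The coefficients solve α - iβ = ω and α + iβ = star ω, the two off-diagonal entries.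
  · refine ⟨(ω + star ω) / 2, Complex.I * (ω - star ω) / 2, by simp, fun x y => ?_⟩
    fin_cases x <;> fin_cases y <;> simp <;> ring_nf <;> simp <;> ring
  · refine ⟨(ω + star ω) / 2, -(Complex.I * (ω - star ω) / 2), by simp, fun x y => ?_⟩
    fin_cases x <;> fin_cases y <;> simp [zmod_two_one_add_one] <;> ring_nf
  · refine ⟨1, 0, fun _ => rfl, fun x y => ?_⟩
    fin_cases x <;> fin_cases y <;> simp [hωω]

/-- Conjugating a Pauli operator by a `T` gate mixes it with its product with `Z`, and only if it
acts as `X` or `Y` on the qubit. -/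
theorem tGate_conj_pauliOp (q : ι) (P : PauliString ι) :
    ∃ α β : ℂ, ((P q).1 = 0 → β = 0) ∧
      (tGate q)ᴴ * pauliOp P * tGate q =
        α • pauliOp P + β • pauliOp (Function.update P q ((P q).1, (P q).2 + 1)) := by
  obtain ⟨α, β, hβ, h⟩ := pauliMatrix_tGate (P q)
  refine ⟨α, β, hβ, ?_⟩
  ext x y
  have hsplit (f : ι → ℂ) : ∏ i, f i = f q * ∏ i ∈ Finset.univ.erase q, f i :=
    (Finset.mul_prod_erase _ f (Finset.mem_univ q)).symm
  simp only [tGate, Matrix.diagonal_conjTranspose, Matrix.mul_diagonal, Matrix.diagonal_mul,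
    Matrix.add_apply, Matrix.smul_apply, smul_eq_mul, pauliOp, Matrix.of_apply, Pi.star_apply]
  rw [hsplit, hsplit fun i => pauliMatrix
    (Function.update P q ((P q).1, (P q).2 + 1) i) (x i) (y i)]
  have hrest : ∏ i ∈ Finset.univ.erase q, pauliMatrix
      (Function.update P q ((P q).1, (P q).2 + 1) i) (x i) (y i) =
      ∏ i ∈ Finset.univ.erase q, pauliMatrix (P i) (x i) (y i) :=
    Finset.prod_congr rfl fun i hi => by
      rw [Function.update_of_ne (Finset.ne_of_mem_erase hi)]
  rw [hrest, Function.update_self, ← mul_assoc, mul_right_comm, h]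
  ring

end TGate

/-! ### Evolution through a doped circuit -/

/-- The evolution of Pauli strings through a CNOT onto a fresh gadget qubit `k`, which is measured
in the computational basis. -/
theorem cnotPauli_gadget {ι : Type} [DecidableEq ι] {t : ℕ} (q : ι) (k : Fin t)
    (P : PauliString ι) (w z : PauliString (Fin t))
    (hw : w k = 0) (hz : z k = 0) (ε : ZMod 2) :
    cnotPauli (Sum.inl q) (Sum.inr k) (Sum.elim P (w + Function.update z k (0, ε))) =
      Sum.elim (Function.update P q ((P q).1, (P q).2 + ε))
        (Function.update w k ((P q).1, ε) + z) := by
  funext i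
  rcases i with i | i
  · by_cases hi : i = q
    · subst hi
      simp only [cnotPauli, Function.update_self, Sum.elim_inl, Sum.elim_inr, Pi.add_apply, hw,
        zero_add]
    · simp only [cnotPauli, Function.update_apply, Sum.elim_inl, Sum.inl.injEq, reduceCtorEq, hi,
        if_false]
  · by_cases hi : i = k
    · subst hi
      simp only [cnotPauli, Function.update_apply, Sum.elim_inl, Sum.elim_inr, reduceCtorEq,
        if_false, if_true, Pi.add_apply, hw, hz, zero_add, add_zero]
    · simp only [cnotPauli, Function.update_apply, Sum.elim_inr, Sum.inr.injEq, reduceCtorEq, hi,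
        if_false, Pi.add_apply]

section Circuit

variable {ι : Type} [Fintype ι] [DecidableEq ι] {t : ℕ}

/-- The Pauli strings `h` on data and gadget qubits that the gadget circuit `V` produces from `P`
by choosing `I` or `Z` on the gadget qubits in `L`, and that have no factor `Z` on gadget qubits. -/
def gadgetBranches (V : QOp (ι ⊕ Fin t)) (L : List (Fin t)) (P : PauliString ι)
    (w : PauliString (Fin t)) : Set (PauliString (ι ⊕ Fin t)) :=
  {h | (∃ z ∈ zGroup (Fin t), (∀ k ∉ L, z k = 0) ∧ ConjugatesTo V (Sum.elim P (w + z)) h) ∧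
    ∀ k, h (Sum.inr k) ≠ (0, 1)}

/-- The evolution of a Pauli operator through gates `T C` is a combination of the outcomes of the
gadget circuit without a factor `Z` on gadget qubits. -/
theorem evolve_mem_span_gadgetBranches (c : Fin t → QOp ι) (hc : ∀ k, IsClifford (c k))
    (q : Fin t → ι) (L : List (Fin t)) (hL : L.Nodup) (P : PauliString ι)
    (w : PauliString (Fin t)) (hwL : ∀ k ∈ L, w k = 0) (hw : ∀ k, w k ≠ (0, 1)) :
    ((L.map fun k => tGate (q k) * c k).prod)ᴴ * pauliOp P *
        (L.map fun k => tGate (q k) * c k).prod ∈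
      Submodule.span ℂ ((fun h => pauliOp (h ∘ Sum.inl)) '' gadgetBranches
        (L.map fun k => cnotGate (Sum.inl (q k)) (Sum.inr k) * extendOp (c k)).prod L P w) := by
  -- Each step peels off the gate applied first in the Heisenberg picture. `P` is the current string
  -- on the circuit qubits, and `w` records the factors already left on the gadget qubits of
  -- processed gates.
  induction L generalizing P w with
  | nil =>
    refine Submodule.subset_span ⟨Sum.elim P w, ⟨⟨0, Submodule.zero_mem _, fun _ _ => rfl, ?_⟩, hw⟩,
      ?_⟩
    · rw [add_zero]
      exact ConjugatesTo.one _
    · simp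
  | cons k L ih =>
    obtain ⟨hkL, hL⟩ := List.nodup_cons.mp hL
    simp only [List.map_cons, List.prod_cons]
    set V := (L.map fun k => tGate (q k) * c k).prod
    set W := (L.map fun k => cnotGate (Sum.inl (q k)) (Sum.inr k) * extendOp (c k)).prod
    have hwk : w k = 0 := hwL k List.mem_cons_self
    -- `ε` chooses I or Z on the measured gadget qubit `k`. The CNOT leaves the factor `((P (q
    -- k)).1, ε)` there, and `hε` says that this is not Z.
    have hbranch (ε : ZMod 2) (hε : ((P (q k)).1, ε) ≠ (0, 1)) :
        (c k * V)ᴴ * pauliOp (Function.update P (q k) ((P (q k)).1, (P (q k)).2 + ε)) *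
            (c k * V) ∈
          Submodule.span ℂ ((fun h => pauliOp (h ∘ Sum.inl)) '' gadgetBranches
            (cnotGate (Sum.inl (q k)) (Sum.inr k) * extendOp (c k) * W) (k :: L) P w) := by
      obtain ⟨Q, hQ⟩ := (hc k).exists_conjugatesTo
        (Function.update P (q k) ((P (q k)).1, (P (q k)).2 + ε))
      obtain ⟨l, hl⟩ := hQ
      have hconj : (c k * V)ᴴ *
          pauliOp (Function.update P (q k) ((P (q k)).1, (P (q k)).2 + ε)) * (c k * V) =
          Complex.I ^ l • (Vᴴ * pauliOp Q * V) := by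
        rw [← Matrix.smul_mul, ← Matrix.mul_smul, ← hl]
        simp only [Matrix.conjTranspose_mul, Matrix.mul_assoc]
      rw [hconj]
      refine Submodule.smul_mem _ _ (Submodule.span_mono (Set.image_mono ?_)
        (ih hL Q (Function.update w k ((P (q k)).1, ε)) ?_ ?_))
      · rintro h ⟨⟨z, hz, hzL, hh⟩, hgood⟩
        have hzk : z k = 0 := hzL k hkL
        refine ⟨⟨Function.update z k (0, ε), fun i => ?_, fun i hi => ?_, ?_⟩, hgood⟩
        · by_cases hik : i = k
          · subst hik; simp
          · simpa [hik] using hz i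
        · rw [List.mem_cons, not_or] at hi
          rw [Function.update_of_ne hi.1]
          exact hzL i hi.2
        · refine ConjugatesTo.mul (ConjugatesTo.mul (conjugatesTo_cnotGate (by simp) _) ?_) hh
          rw [cnotPauli_gadget (q k) k P w z hwk hzk ε]
          exact ConjugatesTo.extendOp ⟨l, hl⟩ _
      · intro i hi
        have hik : i ≠ k := fun h => hkL (h ▸ hi)
        rw [Function.update_of_ne hik]
        exact hwL i (List.mem_cons_of_mem _ hi)
      · intro i
        by_cases hik : i = k
        · subst hik; simpa using hε
        · rw [Function.update_of_ne hik]; exact hw i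
    obtain ⟨α, β, hβ, hT⟩ := tGate_conj_pauliOp (q k) P
    have hsplit : (tGate (q k) * c k * V)ᴴ * pauliOp P * (tGate (q k) * c k * V) =
        α • ((c k * V)ᴴ * pauliOp P * (c k * V)) + β • ((c k * V)ᴴ *
          pauliOp (Function.update P (q k) ((P (q k)).1, (P (q k)).2 + 1)) * (c k * V)) := by
      rw [← Matrix.smul_mul, ← Matrix.mul_smul, ← Matrix.smul_mul, ← Matrix.mul_smul,
        ← Matrix.add_mul, ← Matrix.mul_add, ← hT]
      simp only [Matrix.conjTranspose_mul, Matrix.mul_assoc]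
    rw [hsplit]
    refine Submodule.add_mem _ (Submodule.smul_mem _ _ ?_) ?_
    · simpa using hbranch 0 (by simp)
    -- The branch `ε = 1` would put Z on the gadget qubit exactly when the first bit vanishes, and
    -- then β = 0; otherwise it puts Y.
    · rcases zmod_two_eq (P (q k)).1 with h | h
      · rw [hβ h, zero_smul]
        exact Submodule.zero_mem _
      · exact Submodule.smul_mem _ _ (hbranch 1 (by simp [h]))

/-- The evolution of a stabilizer group through a doped circuit, in terms of the gadget picture. -/
theorem DopedCircuit.evolve_mem_span (C : DopedCircuit ι t)
    (S : Submodule (ZMod 2) (PauliString ι)) {M : QOp ι}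
    (hM : M ∈ Submodule.span ℂ (pauliOp '' (S : Set (PauliString ι)))) :
    C.unitaryᴴ * M * C.unitary ∈ Submodule.span ℂ ((fun h => pauliOp (h ∘ Sum.inl)) ''
      {h : PauliString (ι ⊕ Fin t) | h ∈ heisenberg C.gadgetUnitary (gadgetMeasurement t S) ∧
        ∀ k, h (Sum.inr k) ≠ (0, 1)}) := by
  induction hM using Submodule.span_induction with
  | zero => simp
  | add A B _ _ hA hB =>
    rw [Matrix.mul_add, Matrix.add_mul]
    exact Submodule.add_mem _ hA hB
  | smul a A _ hA =>
    rw [Matrix.mul_smul, Matrix.smul_mul]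
    exact Submodule.smul_mem _ _ hA
  | mem A hA =>
    obtain ⟨P, hP, rfl⟩ := hA
    obtain ⟨Q, l, hl⟩ := (C.isClifford 0).exists_conjugatesTo P
    have hmain := evolve_mem_span_gadgetBranches (fun k => C.clifford k.succ)
      (fun k => C.isClifford k.succ) C.site (List.finRange t) (List.nodup_finRange t) Q 0
      (fun _ _ => rfl) (fun _ => by simp [Prod.ext_iff])
    rw [← List.ofFn_eq_map, ← List.ofFn_eq_map] at hmain
    have hconj : C.unitaryᴴ * pauliOp P * C.unitary = Complex.I ^ l •
        ((List.ofFn fun k : Fin t => tGate (C.site k) * C.clifford k.succ).prodᴴ * pauliOp Q *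
          (List.ofFn fun k : Fin t => tGate (C.site k) * C.clifford k.succ).prod) := by
      rw [← Matrix.smul_mul, ← Matrix.mul_smul, ← hl, DopedCircuit.unitary]
      simp only [Matrix.conjTranspose_mul, Matrix.mul_assoc]
    rw [hconj]
    refine Submodule.smul_mem _ _ (Submodule.span_mono (Set.image_mono ?_) hmain)
    rintro h ⟨⟨z, hz, -, hh⟩, hgood⟩
    refine ⟨Submodule.subset_span ⟨Sum.elim P (0 + z), ⟨?_, ?_⟩, ?_⟩, hgood⟩
    · exact hP
    · rw [zero_add]; exact hz
    · exact ConjugatesTo.mul (ConjugatesTo.extendOp ⟨l, hl⟩ _) hh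

end Circuit

/-- The elements of a doped POVM are combinations of the data parts of those elements of the gadget
stabilizer group that have no factor `Z` on gadget qubits. -/
theorem effectivePOVM_mem_span {n m t : ℕ} (C : DopedCircuit (Fin n ⊕ Fin m) t)
    {ψ : QState (Fin m)} (hψ : IsStabilizerState ψ)
    {S : Submodule (ZMod 2) (PauliString (Fin n ⊕ Fin m))}
    {Φ : OrthonormalBasis (Fin n ⊕ Fin m → Fin 2) ℂ (QState (Fin n ⊕ Fin m))}
    (hΦ : IsStabilizerBasis S Φ) (b : Fin n ⊕ Fin m → Fin 2) :
    effectivePOVM C.unitary ψ Φ b ∈ Submodule.span ℂ ((fun h => pauliOp (h ∘ Sum.inl)) ''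
      {h : PauliString (Fin n ⊕ Fin t) | h ∈ gadgetStabilizerGroup C ψ S ∧
        ∀ k, h (Sum.inr k) ≠ (0, 1)}) := by
  have hmem := C.evolve_mem_span S (vecMulVec_mem_span hΦ.1 (hΦ.2 b))
  rw [effectivePOVM]
  generalize C.unitaryᴴ * Matrix.vecMulVec (Φ b).ofLp (star (Φ b).ofLp) * C.unitary = M at hmem ⊢
  induction hmem using Submodule.span_induction with
  | zero => simp
  | add A B _ _ hA hB =>
    rw [Matrix.mul_add, Matrix.add_mul]
    exact Submodule.add_mem _ hA hB
  | smul a A _ hA =>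
    rw [Matrix.mul_smul, Matrix.smul_mul]
    exact Submodule.smul_mem _ _ hA
  | mem A hA =>
    obtain ⟨h, ⟨hh, hgood⟩, rfl⟩ := hA
    obtain ⟨-, Z, hZ, hZψ⟩ := hψ
    simp only [appendState_conj_pauliOp]
    -- The ancillas contribute the expectation value of their part in ψ, which vanishes outside `Z`;
    -- inside `Z`, the string survives the projection.
    by_cases hanc : (h ∘ Sum.inl) ∘ Sum.inr ∈ Z
    · refine Submodule.smul_mem _ _ (Submodule.subset_span
        ⟨h ∘ Sum.map Sum.inl id, ⟨⟨h, ⟨hh, ?_⟩, rfl⟩, hgood⟩, rfl⟩)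
      exact Submodule.subset_span (hZψ _ hanc)
    · rw [expectation_eq_zero hZ hZψ hanc, zero_smul]
      exact Submodule.zero_mem _

/-! ### Counting -/

/-- The number of elements of `S` without a factor `Z` on the second subregister. -/
theorem ncard_no_Z_le {ι κ : Type} [Fintype ι] [Fintype κ]
    (S : Submodule (ZMod 2) (PauliString (ι ⊕ κ))) :
    {h : PauliString (ι ⊕ κ) | h ∈ S ∧ ∀ k, h (Sum.inr k) ≠ (0, 1)}.ncard ≤
      2 ^ Module.finrank (ZMod 2) (localLeft S) * 3 ^ Fintype.card κ := by
  classical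
  have hcard : Nat.card (localLeft S) = 2 ^ Module.finrank (ZMod 2) (localLeft S) := by
    rw [Module.natCard_eq_pow_finrank (K := ZMod 2), Nat.card_zmod]
  rw [← hcard, Set.ncard_eq_toFinset_card']
  set s := {h : PauliString (ι ⊕ κ) | h ∈ S ∧ ∀ k, h (Sum.inr k) ≠ (0, 1)}.toFinset
  set T : Finset (PauliString κ) := Fintype.piFinset fun _ => {(0, 1)}ᶜ with hTdef
  have hT : T.card = 3 ^ Fintype.card κ := by
    rw [hTdef, Fintype.card_piFinset, Finset.prod_const, Finset.card_compl, Finset.card_univ]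
    rfl
  rw [← hT]
  -- The elements are fibred over their gadget parts. Subtracting a fixed `h₀` injects each nonempty
  -- fibre into `localLeft S`.
  refine Finset.card_le_mul_card_image_of_maps_to (f := fun h => h ∘ Sum.inr) (fun h hh => ?_) _
    fun w _ => ?_
  · simpa [T, s] using (Set.mem_toFinset.mp hh).2
  · rcases (s.filter fun h => h ∘ Sum.inr = w).eq_empty_or_nonempty with he | ⟨h₀, hh₀⟩
    · rw [he]; simp
    · obtain ⟨hs₀, hw₀⟩ := Finset.mem_filter.mp hh₀
      rw [← SetLike.coe_sort_coe, Nat.card_coe_set_eq, Set.ncard_eq_toFinset_card']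
      refine Finset.card_le_card_of_injOn (fun h => h - h₀) (fun h hh => ?_)
        fun _ _ _ _ hab => sub_left_injective hab
      obtain ⟨hs, hw⟩ := Finset.mem_filter.mp hh
      refine Set.mem_toFinset.mpr ⟨S.sub_mem (Set.mem_toFinset.mp hs).1
        (Set.mem_toFinset.mp hs₀).1, ?_⟩
      change (h - h₀) ∘ Sum.inr = 0
      rw [Pi.sub_comp, hw, hw₀, sub_self]

theorem theorem6 (n m t : ℕ) (htn : t ≤ n) (htm : t ≤ m)
    (C : DopedCircuit (Fin n ⊕ Fin m) t)
    (ψ : QState (Fin m)) (hψ : IsStabilizerState ψ)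
    (S : Submodule (ZMod 2) (PauliString (Fin n ⊕ Fin m)))
    (Φ : OrthonormalBasis (Fin n ⊕ Fin m → Fin 2) ℂ (QState (Fin n ⊕ Fin m)))
    (hΦ : IsStabilizerBasis S Φ)
    (hmax : IsMaximallyEntangled (gadgetStabilizerGroup C ψ S)) :
    (povmSpanDim (effectivePOVM C.unitary ψ Φ) : ℝ) ≤ 2 ^ n * (3 / 2 : ℝ) ^ t := by
  set G := gadgetStabilizerGroup C ψ S
  -- As t ≤ n, maximal entanglement means 2t = n + t - dim S_n - dim S_t, that is, dim S_n + dim S_t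
  -- = n - t.
  have hdim : Module.finrank (ZMod 2) (localLeft G) ≤ n - t := by
    unfold IsMaximallyEntangled stabEntanglement at hmax
    rw [min_eq_right htn, div_eq_iff two_ne_zero] at hmax
    have hsum : Module.finrank (ZMod 2) (localLeft G) + Module.finrank (ZMod 2) (localRight G) + t
        = n := by
      have : (Module.finrank (ZMod 2) (localLeft G) : ℚ) +
          Module.finrank (ZMod 2) (localRight G) + t = n := by linarith
      exact_mod_cast this
    omega
  have hspan : povmSpanDim (effectivePOVM C.unitary ψ Φ) ≤ 2 ^ (n - t) * 3 ^ t := by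
    let s := {h : PauliString (Fin n ⊕ Fin t) | h ∈ G ∧ ∀ k, h (Sum.inr k) ≠ (0, 1)}
    calc povmSpanDim (effectivePOVM C.unitary ψ Φ)
        ≤ Module.finrank ℂ (Submodule.span ℂ ((fun h => pauliOp (h ∘ Sum.inl)) '' s)) :=
          Submodule.finrank_mono (Submodule.span_le.mpr (by
            rintro _ ⟨b, rfl⟩
            exact effectivePOVM_mem_span C hψ hΦ b))
      _ ≤ ((fun h => pauliOp (h ∘ Sum.inl)) '' s : Set (QOp (Fin n))).ncard := by
          classical
          rw [Set.ncard_eq_toFinset_card']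
          exact finrank_span_le_card _
      _ ≤ s.ncard := Set.ncard_image_le
      _ ≤ 2 ^ Module.finrank (ZMod 2) (localLeft G) * 3 ^ t := by
          simpa using ncard_no_Z_le G
      _ ≤ 2 ^ (n - t) * 3 ^ t := by gcongr; norm_num
  calc (povmSpanDim (effectivePOVM C.unitary ψ Φ) : ℝ) ≤ 2 ^ (n - t) * 3 ^ t := by
        exact_mod_cast hspan
    _ = 2 ^ n * (3 / 2 : ℝ) ^ t := by
        obtain ⟨d, rfl⟩ := Nat.exists_eq_add_of_le htn
        rw [Nat.add_sub_cancel_left, div_pow, pow_add]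
        field_simp
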